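/- **Theorem 1.** All digraphs are finite, without loops and without parallel edges (a pair of opposite edges $(u,v),(v,u)$ is allowed). For a digraph $D$ let $\delta^0(D)$ be its minimum semidegree, i.e. the minimum of all in-degrees and out-degrees of vertices of $D$. An oriented tree is a digraph obtained from an undirected tree by giving each edge exactly one direction; the total degree of a vertex is the sum of its in-degree and its out-degree. For $p\in[0,1]$, $D(n,p)$ denotes the random digraph on $n$ labelled vertices in which each of the $n(n-1)$ ordered pairs of distinct vertices is an edge independently with probability $p$. We write $T\subseteq D$ if there is an injective map $\phi\colon V(T)\to V(D)$ with $(\phi(u),\phi(v))\in E(D)$ for every $(u,v)\in E(T)$. For all $0<\alpha<1$ and $\Delta\in\mathbb{N}$ there is a constant $c=c(\alpha,\Delta)>0$ such that for every $\varepsilon>0$ there is $N$ (depending only on $\alpha,\Delta,\varepsilon$), which may be taken to be at least $c$, such that the following holds for all $n\ge N$. If $D_\alpha$ is any $n$-vertex digraph with $\delta^0(D_\alpha)\ge\alpha n$, $T$ is any $n$-vertex oriented tree in which every vertex has total degree at most $\Delta$, and $R\sim D(n,c/n)$ is a random digraph on the vertex set of $D_\alpha$, then $$\Pr\bigl[\,T\subseteq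 D_\alpha\cup R\,\bigr]\ \ge\ 1-\varepsilon .$$ In other words, $T\subseteq D_\alpha\cup D(n,c/n)$ with probability tending to $1$ as $n\to\infty$. -/

import Mathlib

namespace Digraph

/-- The number of out-neighbours of `v`. -/
noncomputable def outDegree {V : Type*} (D : Digraph V) (v : V) : ℕ :=
  {w : V | D.Adj v w}.ncard

/-- The number of in-neighbours of `v`. -/
noncomputable def inDegree {V : Type*} (D : Digraph V) (v : V) : ℕ :=
  {w : V | D.Adj w v}.ncard

/-- The minimum of all in- and out-degrees of a (finite, nonempty) digraph. -/
noncomputable def minSemidegree {V : Type*} (D : Digraph V) : ℕ :=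
  ⨅ v : V, min (D.outDegree v) (D.inDegree v)

/-- The maximum over all vertices of a finite digraph of the in-degree plus the out-degree. -/
noncomputable def maxTotalDegree {V : Type*} (D : Digraph V) : ℕ :=
  ⨆ v : V, (D.inDegree v + D.outDegree v)

/-- No edge joins a vertex to itself (Mathlib's `Digraph` allows loops). -/
def Loopless {V : Type*} (D : Digraph V) : Prop :=
  ∀ v, ¬ D.Adj v v

/-- An oriented tree: there are no loops, there is at most one edge between any two vertices,
and the underlying undirected graph is a tree. -/
def IsOrientedTree {V : Type*} (T : Digraph V) : Prop :=
  T.Loopless ∧ (∀ v w, T.Adj v w → ¬ T.Adj w v) ∧ T.toSimpleGraphInclusive.IsTree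

/-- `H` is contained in `D`: some injective map of the vertices sends each edge of `H` to an
edge of `D` with the same direction. -/
def Contained {V W : Type*} (H : Digraph V) (D : Digraph W) : Prop :=
  ∃ φ : V → W, Function.Injective φ ∧ ∀ v w, H.Adj v w → D.Adj (φ v) (φ w)

/-- The digraph with edge set `E`. -/
def ofEdgeSet {V : Type*} (E : Set (V × V)) : Digraph V where
  Adj v w := (v, w) ∈ E

/-- The law of the edge set of the binomial random digraph on `V`: each ordered pair of distinct
vertices is an edge with probability `p`, independently of all the others. -/
noncomputable def binomialRandomEdges (V : Type*) (p : unitInterval) :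
    MeasureTheory.Measure (Set (V × V)) :=
  ProbabilityTheory.setBernoulli {e : V × V | e.1 ≠ e.2} p

/-- The edge probability `c / n`, truncated to `[0, 1]`; it equals `c / n` once `n ≥ c > 0`. -/
noncomputable def edgeProb (c : ℝ) (n : ℕ) : unitInterval :=
  Set.projIcc (0 : ℝ) 1 zero_le_one (c / n)

end Digraph

/-!
With high probability any two sets of `δn` vertices of the random digraph are joined by an edge in
both directions. By the greedy expansion method such a digraph contains every bounded degree
oriented tree on a little less than `n` vertices, so it contains an almost spanning subtree of `T`.

Relabelling the vertices by a uniformly random permutation does not change the law of the random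
digraph, so we may assume that this partial embedding, extended arbitrarily to all of `T`, is a
uniformly random bijection onto the vertices of `D`. Let us call a vertex `p` of `T` switchable for
the host vertices `u` and `w` if in `D` the image of `p` is a neighbour of `u` and the images of the
neighbours of `p` are neighbours of `w`. Linearly many vertices of `T` have disjoint closed
neighbourhoods, and each of them is switchable with a probability bounded away from `0`. Hence, with
exponentially small failure probability, linearly many vertices are switchable for all `u` and `w`.

The missing vertices of `T` are now added one leaf at a time. A leaf `q`, placed at `w` and to be
joined to a vertex placed at `u`, trades places with a switchable vertex `p`. Each such step moves
only two vertices and so destroys only boundedly many switches.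
-/

open Finset

namespace RandomlyPerturbed

section Greedy

variable {A B : Type*} [DecidableEq B] {nb : A → Finset B} {A' X Y : Finset A}
  {W : Finset B} {r : A → ℕ} {m : ℕ} {a : A} {b : B}

/-- Hall's condition for the subsets of `A'` with at most `m` elements, where each `a : A` demands
`r a` private elements of `nb a` and the elements of `W` are already taken. -/
def HallUpTo (nb : A → Finset B) (A' : Finset A) (W : Finset B) (r : A → ℕ) (m : ℕ) : Prop :=
  ∀ X ⊆ A', #X ≤ m → ∑ x ∈ X, r x ≤ #(X.biUnion nb \ W)

/-- Hall's condition holds with equality at `X`: the elements of `X` need everything that is still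
available to them. -/
def Tight (nb : A → Finset B) (W : Finset B) (r : A → ℕ) (X : Finset A) : Prop :=
  #(X.biUnion nb \ W) = ∑ x ∈ X, r x

lemma HallUpTo.mono (h : HallUpTo nb A' W r m) {r' : A → ℕ} (hr : ∀ x, r' x ≤ r x) :
    HallUpTo nb A' W r' m :=
  fun X hX hXm ↦ (sum_le_sum fun x _ ↦ hr x).trans (h X hX hXm)

variable [DecidableEq A]

lemma card_biUnion_sdiff_union_add_inter_le (nb : A → Finset B) (W : Finset B) (X Y : Finset A) :
    #((X ∪ Y).biUnion nb \ W) + #((X ∩ Y).biUnion nb \ W) ≤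
      #(X.biUnion nb \ W) + #(Y.biUnion nb \ W) := by
  have hunion : (X ∪ Y).biUnion nb \ W = X.biUnion nb \ W ∪ Y.biUnion nb \ W := by
    rw [union_biUnion, union_sdiff_distrib]
  have hinter : (X ∩ Y).biUnion nb \ W ⊆ (X.biUnion nb \ W) ∩ (Y.biUnion nb \ W) :=
    subset_inter (sdiff_subset_sdiff (biUnion_subset_biUnion_of_subset_left _ inter_subset_left)
      subset_rfl) (sdiff_subset_sdiff (biUnion_subset_biUnion_of_subset_left _ inter_subset_right)
      subset_rfl)
  rw [hunion, ← card_union_add_card_inter (X.biUnion nb \ W)]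
  exact Nat.add_le_add_left (card_le_card hinter) _

lemma HallUpTo.tight_union (h : HallUpTo nb A' W r m) (hX : X ⊆ A') (hY : Y ⊆ A')
    (hm : #(X ∪ Y) ≤ m) (hXt : Tight nb W r X) (hYt : Tight nb W r Y) :
    Tight nb W r (X ∪ Y) := by
  have hunion := h _ (union_subset hX hY) hm
  have hinter := h (X ∩ Y) (inter_subset_left.trans hX)
    ((card_le_card (inter_subset_left.trans subset_union_left)).trans hm)
  have hsub := card_biUnion_sdiff_union_add_inter_le nb W X Y
  have hsum := sum_union_inter (s₁ := X) (s₂ := Y) (f := r)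
  unfold Tight at *
  omega

lemma HallUpTo.exists_tight_of_not_insert (h : HallUpTo nb A' W r m) (hra : 0 < r a)
    (hb : ¬ HallUpTo nb A' (insert b W) (Function.update r a (r a - 1)) m) :
    ∃ X ⊆ A', #X ≤ m ∧ a ∉ X ∧ Tight nb W r X ∧ b ∈ X.biUnion nb := by
  unfold HallUpTo at hb
  push Not at hb
  obtain ⟨X, hX, hXm, hlt⟩ := hb
  have hhall := h X hX hXm
  rw [sdiff_insert] at hlt
  have herase := pred_card_le_card_erase (s := X.biUnion nb \ W) (a := b)
  have haX : a ∉ X := by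
    intro haX
    have hsum : ∑ x ∈ X, Function.update r a (r a - 1) x + 1 = ∑ x ∈ X, r x := by
      rw [sum_update_of_mem haX, ← add_sum_erase X r haX, sdiff_singleton_eq_erase]
      omega
    omega
  rw [sum_update_of_notMem haX] at hlt
  have hbX : b ∈ X.biUnion nb \ W := by
    by_contra hbX
    rw [erase_eq_of_notMem hbX] at hlt
    omega
  exact ⟨X, hX, hXm, haX, by unfold Tight; omega, (mem_sdiff.1 hbX).1⟩

omit [DecidableEq A] in
lemma HallUpTo.exists_tight_cover (h : HallUpTo nb A' W r (2 * m))
    (hsmall : ∀ X ⊆ A', #X ≤ 2 * m → Tight nb W r X → #X ≤ m) (s : Finset B)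
    (hs : ∀ b ∈ s, ∃ X ⊆ A', #X ≤ 2 * m ∧ a ∉ X ∧ Tight nb W r X ∧ b ∈ X.biUnion nb) :
    ∃ X ⊆ A', #X ≤ 2 * m ∧ a ∉ X ∧ Tight nb W r X ∧ s ⊆ X.biUnion nb := by
  classical
  induction s using Finset.induction_on with
  | empty => exact ⟨∅, by simp [Tight]⟩
  | insert b s _ ih =>
    obtain ⟨X, hX, hXm, haX, hXt, hsX⟩ := ih fun b' hb' ↦ hs b' (mem_insert_of_mem hb')
    obtain ⟨Y, hY, hYm, haY, hYt, hbY⟩ := hs b (mem_insert_self b s)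
    have hm : #(X ∪ Y) ≤ 2 * m := by
      have := card_union_le X Y
      have := hsmall X hX hXm hXt
      have := hsmall Y hY hYm hYt
      omega
    refine ⟨X ∪ Y, union_subset hX hY, hm, by simp [haX, haY], h.tight_union hX hY hm hXt hYt, ?_⟩
    rw [union_biUnion]
    exact insert_subset (mem_union_right _ hbY) (hsX.trans subset_union_left)

/-- If no `b` could be given to `a`, then every available `b` lies in a tight set avoiding `a`.
The union of these sets is tight, covers everything that `a` could get, and so contradicts Hall's
condition once `a` is added to it. -/
theorem HallUpTo.exists_insert (h : HallUpTo nb A' W r (2 * m))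
    (hlarge : ∀ X ⊆ A', m ≤ #X → #X ≤ 2 * m → ∑ x ∈ X, r x < #(X.biUnion nb \ W))
    (ha : a ∈ A') (hra : 0 < r a) :
    ∃ b ∈ nb a, b ∉ W ∧
      HallUpTo nb A' (insert b W) (Function.update r a (r a - 1)) (2 * m) := by
  by_contra! hcon
  have hsmall : ∀ X ⊆ A', #X ≤ 2 * m → Tight nb W r X → #X < m := by
    intro X hX hXm hXt
    by_contra! hmX
    exact (hlarge X hX hmX hXm).ne' hXt
  obtain ⟨X, hX, hXm, haX, hXt, hsub⟩ := h.exists_tight_cover (a := a) (s := nb a \ W)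
    (fun X hX hXm hXt ↦ (hsmall X hX hXm hXt).le) fun b hb ↦
      h.exists_tight_of_not_insert hra (hcon b (mem_sdiff.1 hb).1 (mem_sdiff.1 hb).2)
  have hhall := h (insert a X) (insert_subset ha hX) (by
    have := hsmall X hX hXm hXt
    have := card_insert_le a X
    omega)
  have hcover : (insert a X).biUnion nb \ W ⊆ X.biUnion nb \ W := by
    rw [biUnion_insert, union_sdiff_distrib]
    exact union_subset (fun y hy ↦ mem_sdiff.2 ⟨hsub hy, (mem_sdiff.1 hy).2⟩) subset_rfl
  rw [sum_insert haX] at hhall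
  have hcard := card_le_card hcover
  unfold Tight at hXt
  omega

omit [DecidableEq A] in
/-- A maximal set `Z` violating expansion has fewer than `m` elements, and adding to `Z` a set that
does not expand outside the image of `Z` would give a larger violating set. -/
theorem exists_expanding_core [Finite A] (Γ : A → Finset B) (f : A → B) {e : ℕ}
    (hlarge : ∀ X Z : Finset A, m ≤ #X → #X ≤ 2 * m → #Z ≤ 2 * m →
      e * #X < #(X.biUnion Γ \ Z.image f)) :
    ∃ Z : Finset A, #Z < m ∧ ∀ X, Disjoint X Z → #X ≤ 2 * m →
      e * #X ≤ #(X.biUnion Γ \ Z.image f) := by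
  classical
  have := Fintype.ofFinite A
  obtain ⟨Z, hZ, hmax⟩ := exists_max_image
    {Z : Finset A | #Z ≤ 2 * m ∧ #(Z.biUnion Γ \ Z.image f) ≤ e * #Z} card ⟨∅, by simp⟩
  simp only [mem_filter, mem_univ, true_and] at hZ hmax
  obtain ⟨hZm, hZe⟩ := hZ
  have hZlt : #Z < m := by
    by_contra! h
    exact (hlarge Z Z h hZm hZm).not_ge hZe
  refine ⟨Z, hZlt, fun X hXZ hXm ↦ ?_⟩
  by_contra! hlt
  have hXlt : #X < m := by
    by_contra! h
    exact (hlarge X Z h hXm hZm).not_gt hlt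
  have hXpos : 0 < #X := Nat.pos_of_ne_zero fun h ↦ by simp [h] at hlt
  have hcard : #(Z ∪ X) = #Z + #X := card_union_of_disjoint hXZ.symm
  have hsub : (Z ∪ X).biUnion Γ \ (Z ∪ X).image f ⊆
      (Z.biUnion Γ \ Z.image f) ∪ (X.biUnion Γ \ Z.image f) := by
    rw [union_biUnion, ← union_sdiff_distrib]
    exact sdiff_subset_sdiff subset_rfl (image_subset_image subset_union_left)
  have hviol : #((Z ∪ X).biUnion Γ \ (Z ∪ X).image f) ≤ e * #(Z ∪ X) := by
    rw [hcard, mul_add]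
    exact ((card_le_card hsub).trans (card_union_le _ _)).trans (by omega)
  have := hmax (Z ∪ X) ⟨by omega, hviol⟩
  omega

end Greedy

section Trees

open Digraph

variable {V W : Type*} {T D : Digraph V} {o : Bool} {S : Finset V} {a b q s x y : V}

lemma eq_of_adj_of_isAcyclic {G : SimpleGraph V} (hG : G.IsAcyclic) {S : Set V}
    (hS : (G.induce S).Preconnected) (ha : a ∈ S) (hb : b ∈ S) (hq : q ∉ S) (haq : G.Adj a q)
    (hbq : G.Adj b q) : a = b := by
  classical
  obtain ⟨p, hp, hqp⟩ : ∃ p : G.Walk a b, p.IsPath ∧ q ∉ p.support := by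
    obtain ⟨p, hp⟩ := (hS ⟨a, ha⟩ ⟨b, hb⟩).exists_isPath
    refine ⟨p.map (SimpleGraph.Embedding.induce S).toHom, hp.map Subtype.val_injective,
      fun hmem ↦ ?_⟩
    obtain ⟨x, -, rfl⟩ := List.mem_map.1 (SimpleGraph.Walk.support_map _ p ▸ hmem)
    exact hq x.2
  have hlength : (p.concat hbq).length = haq.toWalk.length := congrArg (fun w ↦ w.1.length) <|
    (hG.subsingleton_path a q).elim ⟨_, hp.concat hqp hbq⟩ (.singleton haq)
  rw [SimpleGraph.Walk.length_concat, SimpleGraph.Walk.length_cons,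
    Nat.add_right_cancel_iff] at hlength
  exact SimpleGraph.Walk.eq_of_length_eq_zero hlength

/-- The adjacency relation of `D` read in either direction: `y` is an out-neighbour of `x` if the
orientation `o` is `true`, and an in-neighbour of `x` if it is `false`. -/
def DirAdj (D : Digraph V) : Bool → V → V → Prop
  | true, x, y => D.Adj x y
  | false, x, y => D.Adj y x

@[simp] lemma dirAdj_true : DirAdj D true x y ↔ D.Adj x y := Iff.rfl

@[simp] lemma dirAdj_false : DirAdj D false x y ↔ D.Adj y x := Iff.rfl

lemma not_dirAdj_self (hD : D.Loopless) : ¬ DirAdj D o x x := by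
  cases o <;> exact hD x

lemma adj_iff_exists_dirAdj (hT : T.IsOrientedTree) :
    T.toSimpleGraphInclusive.Adj x y ↔ ∃ o, DirAdj T o x y := by
  have hne : T.Adj x y ∨ T.Adj y x → x ≠ y := by
    rintro h rfl
    exact hT.1 x (or_self_iff.1 h)
  simpa [toSimpleGraphInclusive, SimpleGraph.fromRel_adj, or_comm] using hne

lemma dirAdj_unique (hT : T.IsOrientedTree) {o' : Bool} (h : DirAdj T o x y)
    (h' : DirAdj T o' x y) : o' = o := by
  cases o <;> cases o'
  · rfl
  · exact absurd h (hT.2.1 _ _ h')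
  · exact absurd h' (hT.2.1 _ _ h)
  · rfl

/-- Outside `S` lies the vertex `q`, whose only neighbour in `S` is `s`, in direction `o`: the
vertices of a tree are embedded one by one along such pendant edges. -/
structure Pendant (T : Digraph V) (S : Finset V) (s q : V) (o : Bool) : Prop where
  mem : s ∈ S
  notMem : q ∉ S
  dirAdj : DirAdj T o s q
  eq_of_dirAdj : ∀ a ∈ S, ∀ o', DirAdj T o' a q → a = s ∧ o' = o

lemma exists_pendant [Fintype V] (hT : T.IsOrientedTree)
    (hS : (T.toSimpleGraphInclusive.induce (S : Set V)).Connected) (hne : S ≠ univ) :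
    ∃ s q o, Pendant T S s q o := by
  obtain ⟨v, hv⟩ : ∃ v, v ∉ S := by
    by_contra! h
    exact hne (eq_univ_of_forall h)
  obtain ⟨⟨r, hr⟩⟩ := hS.nonempty
  obtain ⟨p⟩ := hT.2.2.connected.preconnected r v
  obtain ⟨e, -, hs, hq⟩ := p.exists_boundary_dart (S : Set V) hr hv
  obtain ⟨o, ho⟩ := (adj_iff_exists_dirAdj hT).1 e.adj
  refine ⟨e.fst, e.snd, o, hs, hq, ho, fun a ha o' ho' ↦ ?_⟩
  obtain rfl := eq_of_adj_of_isAcyclic hT.2.2.isAcyclic hS.preconnected ha hs hq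
    ((adj_iff_exists_dirAdj hT).2 ⟨o', ho'⟩) e.adj
  exact ⟨rfl, dirAdj_unique hT ho ho'⟩

/-- `φ` maps the edges of `T` inside `S` to edges of `D`. -/
def EmbedsOn (T : Digraph V) (D : Digraph W) (S : Finset V) (φ : V → W) : Prop :=
  ∀ a ∈ S, ∀ b ∈ S, T.Adj a b → D.Adj (φ a) (φ b)

lemma embedsOn_singleton (hT : T.Loopless) (D : Digraph W) (φ : V → W) (x : V) :
    EmbedsOn T D {x} φ := by
  intro a ha b hb hab
  rw [mem_singleton] at ha hb
  subst ha hb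
  exact absurd hab (hT _)

variable [DecidableEq V]

lemma Pendant.connected_induce_insert (hT : T.IsOrientedTree) (h : Pendant T S s q o)
    (hS : (T.toSimpleGraphInclusive.induce (S : Set V)).Connected) :
    (T.toSimpleGraphInclusive.induce ((insert q S : Finset V) : Set V)).Connected := by
  rw [coe_insert, ← Set.union_singleton]
  exact SimpleGraph.connected_induce_union hS.preconnected .of_subsingleton (mem_coe.2 h.mem)
    (Set.mem_singleton q) ((adj_iff_exists_dirAdj hT).2 ⟨o, h.dirAdj⟩)

theorem exists_connected_superset [Fintype V] (hT : T.IsOrientedTree) {P : Finset V → Prop}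
    {S₀ : Finset V} {m : ℕ} (hconn : (T.toSimpleGraphInclusive.induce (S₀ : Set V)).Connected)
    (hP : P S₀) (hm : #S₀ ≤ m) (hmV : m ≤ Fintype.card V)
    (hstep : ∀ S s q o, S₀ ⊆ S → #S < m → Pendant T S s q o → P S → P (insert q S)) :
    ∃ S, S₀ ⊆ S ∧ #S = m ∧ (T.toSimpleGraphInclusive.induce (S : Set V)).Connected ∧ P S := by
  induction m, hm using Nat.le_induction with
  | base => exact ⟨S₀, subset_rfl, rfl, hconn, hP⟩
  | succ m _ ih =>
    obtain ⟨S, hsub, hcard, hSconn, hPS⟩ := ih (by omega) fun S s q o hsub hlt ↦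
      hstep S s q o hsub (hlt.trans m.lt_succ_self)
    have hne : S ≠ univ := by
      rintro rfl
      rw [card_univ] at hcard
      omega
    obtain ⟨s, q, o, hpend⟩ := exists_pendant hT hSconn hne
    exact ⟨insert q S, hsub.trans (subset_insert q S),
      by rw [card_insert_of_notMem hpend.notMem, hcard], hpend.connected_induce_insert hT hSconn,
      hstep S s q o hsub (by omega) hpend hPS⟩

lemma embedsOn_insert {D : Digraph W} {φ ψ : V → W} (hT : T.Loopless) (h : EmbedsOn T D S φ)
    (hpend : Pendant T S s q o) (hψ : ∀ a ∈ S, ψ a = φ a) (hq : DirAdj D o (φ s) (ψ q)) :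
    EmbedsOn T D (insert q S) ψ := by
  have hdir : ∀ a ∈ S, ∀ o', DirAdj T o' a q → DirAdj D o' (ψ a) (ψ q) := by
    intro a ha o' hadj
    obtain ⟨rfl, rfl⟩ := hpend.eq_of_dirAdj a ha o' hadj
    rwa [hψ a ha]
  intro a ha b hb hab
  rcases mem_insert.1 ha with rfl | ha' <;> rcases mem_insert.1 hb with rfl | hb'
  · exact absurd hab (hT _)
  · exact hdir b hb' false hab
  · exact hdir a ha' true hab
  · rw [hψ a ha', hψ b hb']
    exact h a ha' b hb' hab

end Trees

section AlmostSpanning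

open Digraph

variable {V : Type*} {D R T : Digraph V} {d k : ℕ} {o : Bool} {S : Finset V} {ψ : Equiv.Perm V}
  {q s v x y : V}

/-- Any two sets of at least `k` vertices are joined by an edge in each direction. -/
def IsJoined (R : Digraph V) (k : ℕ) : Prop :=
  ∀ X Y : Finset V, k ≤ #X → k ≤ #Y → ∃ x ∈ X, ∃ y ∈ Y, R.Adj x y

lemma IsJoined.exists_dirAdj (hR : IsJoined R k) (o : Bool) {X Y : Finset V} (hX : k ≤ #X)
    (hY : k ≤ #Y) : ∃ x ∈ X, ∃ y ∈ Y, DirAdj R o x y := by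
  cases o
  · obtain ⟨y, hy, x, hx, h⟩ := hR Y X hY hX
    exact ⟨x, hx, y, hy, h⟩
  · exact hR X Y hX hY

variable [Fintype V]

open Classical in
/-- The out-neighbours (`o = true`) or in-neighbours (`o = false`) of `x`. -/
noncomputable def dirNbrs (D : Digraph V) (o : Bool) (x : V) : Finset V :=
  {y | DirAdj D o x y}

@[simp] lemma mem_dirNbrs : y ∈ dirNbrs D o x ↔ DirAdj D o x y := by
  simp [dirNbrs]

variable [DecidableEq V]

lemma IsJoined.card_lt_card_biUnion (hR : IsJoined R k) {X : Finset (V × Bool)}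
    (hX : 2 * k ≤ #X) : Fintype.card V < #(X.biUnion fun z ↦ dirNbrs R z.2 z.1) + k := by
  obtain ⟨o, ho⟩ : ∃ o, k ≤ #{x | (x, o) ∈ X} := by
    by_contra! h
    have hsub : X ⊆ (univ.filter fun x ↦ (x, true) ∈ X).image (·, true) ∪
        (univ.filter fun x ↦ (x, false) ∈ X).image (·, false) := by
      rintro ⟨x, o⟩ hxo
      cases o <;> simpa using hxo
    have hcard := (card_le_card hsub).trans (card_union_le _ _)
    have htrue := card_image_le (s := {x | (x, true) ∈ X}) (f := (·, true))
    have hfalse := card_image_le (s := {x | (x, false) ∈ X}) (f := (·, false))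
    have := h true
    have := h false
    omega
  by_contra! h
  obtain ⟨x, hx, y, hy, hxy⟩ := hR.exists_dirAdj o ho
    (Y := (X.biUnion fun z ↦ dirNbrs R z.2 z.1)ᶜ) (by rw [card_compl]; omega)
  exact mem_compl.1 hy (mem_biUnion.2 ⟨(x, o), (mem_filter.1 hx).2, mem_dirNbrs.2 hxy⟩)

/-- How many neighbours of the host vertex `z.1` in direction `z.2` must still be kept available:
when `z.1` is the image of a vertex of `S`, those tree neighbours of the latter that are not in `S`,
and `d` otherwise. -/
noncomputable def demand (T : Digraph V) (d : ℕ) (S : Finset V) (ψ : Equiv.Perm V)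
    (z : V × Bool) : ℕ :=
  if ψ.symm z.1 ∈ S then #(dirNbrs T z.2 (ψ.symm z.1) \ S) else d

lemma demand_of_mem (hv : v ∈ S) : demand T d S ψ (ψ v, o) = #(dirNbrs T o v \ S) := by
  simp [demand, hv]

lemma demand_le (hd : ∀ o v, #(dirNbrs T o v) ≤ d) (z : V × Bool) : demand T d S ψ z ≤ d := by
  unfold demand
  split_ifs
  · exact (card_le_card sdiff_subset).trans (hd _ _)
  · rfl

lemma sum_demand_le (hd : ∀ o v, #(dirNbrs T o v) ≤ d) (X : Finset (V × Bool)) :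
    ∑ z ∈ X, demand T d S ψ z ≤ #X * d :=
  sum_le_card_nsmul X _ d fun z _ ↦ demand_le hd z

lemma demand_insert_le (hd : ∀ o v, #(dirNbrs T o v) ≤ d) (hpend : Pendant T S s q o)
    {ψ' : Equiv.Perm V} (hψ : ∀ v ∈ S, ψ' v = ψ v) (z : V × Bool) :
    demand T d (insert q S) ψ' z ≤
      Function.update (demand T d S ψ) (ψ s, o) (demand T d S ψ (ψ s, o) - 1) z := by
  obtain ⟨x, o'⟩ := z
  obtain ⟨v, rfl⟩ := ψ'.surjective x
  by_cases hv : v ∈ S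
  · rw [demand_of_mem (mem_insert_of_mem hv), hψ v hv, sdiff_insert]
    by_cases hz : (ψ v, o') = (ψ s, o)
    · obtain ⟨hvs, rfl⟩ := Prod.mk.inj hz
      obtain rfl := ψ.injective hvs
      rw [Function.update_self, demand_of_mem hv, card_erase_of_mem]
      exact mem_sdiff.2 ⟨mem_dirNbrs.2 hpend.dirAdj, hpend.notMem⟩
    · rw [Function.update_of_ne hz, demand_of_mem hv]
      exact card_erase_le
  · have hx : ψ.symm (ψ' v) ∉ S := by
      intro h
      refine hv (?_ : v ∈ S)
      rwa [← ψ'.injective ((hψ _ h).trans (ψ.apply_symm_apply _))]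
    rw [Function.update_of_ne]
    · exact (demand_le hd _).trans_eq (if_neg hx).symm
    · rintro h
      rw [(Prod.mk.inj h).1, ψ.symm_apply_apply] at hx
      exact hx hpend.mem

/-- The invariant of the greedy embedding: `ψ` embeds the part `S` of the tree into `R` outside the
core `Z`, and Hall's condition guarantees room for the rest. Only the values of `ψ` on `S` matter;
having a permutation of `V` from the start spares extending `ψ` at the end. -/
structure GreedyState (R T : Digraph V) (d k : ℕ) (Z : Finset (V × Bool)) (S : Finset V)
    (ψ : Equiv.Perm V) : Prop where
  embedsOn : EmbedsOn T R S ψ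
  avoids : ∀ v ∈ S, ψ v ∉ Z.image Prod.fst
  hall : HallUpTo (fun z ↦ dirNbrs R z.2 z.1) Zᶜ (Z.image Prod.fst ∪ S.image ψ) (demand T d S ψ)
    (2 * (2 * k))

lemma exists_greedyState_singleton (hT : T.Loopless) (hd : ∀ o v, #(dirNbrs T o v) ≤ d)
    {Z : Finset (V × Bool)} (hZ : #Z < Fintype.card V)
    (hcore : ∀ X, Disjoint X Z → #X ≤ 2 * (2 * k) →
      (d + 1) * #X ≤ #((X.biUnion fun z ↦ dirNbrs R z.2 z.1) \ Z.image Prod.fst)) (root : V) :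
    ∃ ψ, GreedyState R T d k Z {root} ψ := by
  obtain ⟨x, hx⟩ : ∃ x, x ∉ Z.image Prod.fst := by
    by_contra! h
    have := card_le_card (fun x _ ↦ h x : (univ : Finset V) ⊆ Z.image Prod.fst)
    have := card_image_le (s := Z) (f := Prod.fst)
    rw [card_univ] at *
    omega
  refine ⟨Equiv.swap root x, embedsOn_singleton hT R _ root, by simpa using hx, fun X hX hXk ↦ ?_⟩
  rcases X.eq_empty_or_nonempty with rfl | hne
  · simp
  have hexp := hcore X (disjoint_left.2 fun z hz ↦ mem_compl.1 (hX hz)) hXk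
  have hsum := sum_demand_le (S := {root}) (ψ := Equiv.swap root x) hd X
  have hroot := le_card_sdiff ({x} : Finset V)
    ((X.biUnion fun z ↦ dirNbrs R z.2 z.1) \ Z.image Prod.fst)
  rw [image_singleton, Equiv.swap_apply_left, ← sup_eq_union, ← sdiff_sdiff]
  rw [card_singleton] at hroot
  have hmul : (d + 1) * #X = #X * d + #X := by ring
  have := hne.card_pos
  omega

lemma GreedyState.exists_insert (hR : IsJoined R k) (hT : T.Loopless)
    (hd : ∀ o v, #(dirNbrs T o v) ≤ d) {Z : Finset (V × Bool)} (hZ : #Z < 2 * k)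
    (hψ : GreedyState R T d k Z S ψ) (hS : #S + (4 * d + 9) * k < Fintype.card V)
    (hpend : Pendant T S s q o) : ∃ ψ', GreedyState R T d k Z (insert q S) ψ' := by
  have hlarge : ∀ X ⊆ Zᶜ, 2 * k ≤ #X → #X ≤ 2 * (2 * k) → ∑ z ∈ X, demand T d S ψ z <
      #((X.biUnion fun z ↦ dirNbrs R z.2 z.1) \ (Z.image Prod.fst ∪ S.image ψ)) := by
    intro X _ hXk hXk'
    have hjoined := hR.card_lt_card_biUnion hXk
    have hsdiff := le_card_sdiff (Z.image Prod.fst ∪ S.image ψ)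
      (X.biUnion fun z ↦ dirNbrs R z.2 z.1)
    have hused : #(Z.image Prod.fst ∪ S.image ψ) ≤ #Z + #S :=
      (card_union_le _ _).trans (add_le_add card_image_le card_image_le)
    have hsum := (sum_demand_le (S := S) (ψ := ψ) hd X).trans (Nat.mul_le_mul_right d hXk')
    have : (4 * d + 9) * k = 2 * (2 * k) * d + 9 * k := by ring
    omega
  have hs : (ψ s, o) ∈ Zᶜ := mem_compl.2 fun h ↦ hψ.avoids s hpend.mem (mem_image_of_mem _ h)
  have hpos : 0 < demand T d S ψ (ψ s, o) := by
    rw [demand_of_mem hpend.mem]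
    exact card_pos.2 ⟨q, mem_sdiff.2 ⟨mem_dirNbrs.2 hpend.dirAdj, hpend.notMem⟩⟩
  obtain ⟨b, hb, hbW, hhall⟩ := hψ.hall.exists_insert hlarge hs hpos
  rw [mem_union, not_or] at hbW
  let ψ' := ψ.trans (Equiv.swap (ψ q) b)
  have hψ'q : ψ' q = b := Equiv.swap_apply_left _ _
  have hψ'S : ∀ v ∈ S, ψ' v = ψ v := fun v hv ↦ Equiv.swap_apply_of_ne_of_ne
    (ψ.injective.ne (ne_of_mem_of_not_mem hv hpend.notMem))
    (ne_of_mem_of_not_mem (mem_image_of_mem ψ hv) hbW.2)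
  refine ⟨ψ', embedsOn_insert hT hψ.embedsOn hpend hψ'S ?_, ?_, ?_⟩
  · rw [hψ'q]
    exact mem_dirNbrs.1 hb
  · rw [forall_mem_insert, hψ'q]
    exact ⟨hbW.1, fun v hv ↦ hψ'S v hv ▸ hψ.avoids v hv⟩
  · rw [image_insert, hψ'q, image_congr hψ'S, union_insert]
    exact hhall.mono (demand_insert_le hd hpend hψ'S)

omit [DecidableEq V] in
theorem IsJoined.exists_embedsOn (hR : IsJoined R k) (hT : T.IsOrientedTree)
    (hd : ∀ o v, #(dirNbrs T o v) ≤ d) (hV : (4 * d + 9) * k < Fintype.card V) :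
    ∃ (S : Finset V) (φ : Equiv.Perm V), #S + (4 * d + 9) * k = Fintype.card V ∧
      (T.toSimpleGraphInclusive.induce (S : Set V)).Connected ∧ EmbedsOn T R S φ := by
  classical
  have hlarge : ∀ X Z : Finset (V × Bool), 2 * k ≤ #X → #X ≤ 2 * (2 * k) → #Z ≤ 2 * (2 * k) →
      (d + 1) * #X < #((X.biUnion fun z ↦ dirNbrs R z.2 z.1) \ Z.image Prod.fst) := by
    intro X Z hX hXk hZ
    have hjoined := hR.card_lt_card_biUnion hX
    have hsdiff := le_card_sdiff (Z.image Prod.fst) (X.biUnion fun z ↦ dirNbrs R z.2 z.1)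
    have hcard : #(Z.image Prod.fst) ≤ #Z := card_image_le
    have hmul := Nat.mul_le_mul_left (d + 1) hXk
    have : (4 * d + 9) * k = (d + 1) * (2 * (2 * k)) + 5 * k := by ring
    omega
  obtain ⟨Z, hZ, hcore⟩ := exists_expanding_core _ Prod.fst hlarge
  obtain ⟨root⟩ := hT.2.2.connected.nonempty
  have hroot : (T.toSimpleGraphInclusive.induce (({root} : Finset V) : Set V)).Connected := by
    rw [coe_singleton]
    exact { preconnected := .of_subsingleton, nonempty := inferInstance }
  have hk : 9 * k ≤ (4 * d + 9) * k := Nat.mul_le_mul_right k (by omega)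
  obtain ⟨S, -, hS, hconn, ψ, hψ⟩ := exists_connected_superset hT
    (P := fun S ↦ ∃ ψ, GreedyState R T d k Z S ψ) (S₀ := {root})
    (m := Fintype.card V - (4 * d + 9) * k) hroot
    (exists_greedyState_singleton hT.1 hd (by omega) hcore root) (by rw [card_singleton]; omega)
    (Nat.sub_le _ _) fun S s q o _ hlt hpend ⟨ψ, hψ⟩ ↦
      hψ.exists_insert hR hT.1 hd hZ (by omega) hpend
  exact ⟨S, ψ, by omega, hconn, hψ.embedsOn⟩

end AlmostSpanning

section Switching

open Digraph

variable {V : Type*} [Fintype V] {D R T : Digraph V} {d l : ℕ} {o : Bool} {S : Finset V}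
  {φ θ : Equiv.Perm V} {a p q s u v w : V}

open Classical in
/-- The vertices `p` of `T` whose place in the embedding `φ` may be taken by a new neighbour of the
vertex placed at `u`, while `p` moves to `w`: the edges needed for this are all in `D`. -/
noncomputable def switchable (T D : Digraph V) (φ : V → V) (o : Bool) (u w : V) : Finset V :=
  {p | DirAdj D o u (φ p) ∧ ∀ o' a, DirAdj T o' p a → DirAdj D o' w (φ a)}

lemma mem_switchable {φ : V → V} : p ∈ switchable T D φ o u w ↔
    DirAdj D o u (φ p) ∧ ∀ o' a, DirAdj T o' p a → DirAdj D o' w (φ a) := by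
  simp [switchable]

lemma switchable_subset_sup (T D R : Digraph V) (φ : V → V) (o : Bool) (u w : V) :
    switchable T D φ o u w ⊆ switchable T (D ⊔ R) φ o u w := by
  have hle : ∀ o x y, DirAdj D o x y → DirAdj (D ⊔ R) o x y := by
    rintro (_ | _) x y h <;> exact Or.inl h
  intro p hp
  rw [mem_switchable] at hp ⊢
  exact ⟨hle _ _ _ hp.1, fun o' a h ↦ hle _ _ _ (hp.2 o' a h)⟩

variable [DecidableEq V]

/-- The closed neighbourhood of `v` in the underlying undirected graph of `T`. -/
noncomputable def closedNbrs (T : Digraph V) (v : V) : Finset V :=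
  insert v (dirNbrs T true v ∪ dirNbrs T false v)

lemma mem_closedNbrs : a ∈ closedNbrs T v ↔ a = v ∨ ∃ o, DirAdj T o v a := by
  simp [closedNbrs, or_comm]

lemma mem_closedNbrs_comm : a ∈ closedNbrs T v ↔ v ∈ closedNbrs T a := by
  simp only [mem_closedNbrs, Bool.exists_bool, dirAdj_true, dirAdj_false, eq_comm (a := a),
    or_comm (a := T.Adj a v)]

lemma card_closedNbrs_le (hd : ∀ o v, #(dirNbrs T o v) ≤ d) (v : V) :
    #(closedNbrs T v) ≤ 2 * d + 1 := by
  have hinsert := card_insert_le v (dirNbrs T true v ∪ dirNbrs T false v)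
  have hunion := card_union_le (dirNbrs T true v) (dirNbrs T false v)
  have := hd true v
  have := hd false v
  unfold closedNbrs
  omega

lemma mem_switchable_of_eqOn {φ θ : V → V} (h : ∀ a ∈ closedNbrs T p, θ a = φ a)
    (hp : p ∈ switchable T D φ o u w) : p ∈ switchable T D θ o u w := by
  rw [mem_switchable] at hp ⊢
  refine ⟨h p (mem_closedNbrs.2 (.inl rfl)) ▸ hp.1, fun o' a ha ↦ ?_⟩
  exact h a (mem_closedNbrs.2 (.inr ⟨o', ha⟩)) ▸ hp.2 o' a ha

lemma embedsOn_swap_trans (hT : T.Loopless) (hθ : EmbedsOn T D S θ) (hpend : Pendant T S s q o)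
    (hp : p ∈ switchable T D θ o (θ s) (θ q)) (hps : p ≠ s) :
    EmbedsOn T D (insert q S) ((Equiv.swap p q).trans θ) := by
  rw [mem_switchable] at hp
  set θ' := (Equiv.swap p q).trans θ
  have hθ'p : θ' p = θ q := congrArg θ (Equiv.swap_apply_left p q)
  have hθ'q : θ' q = θ p := congrArg θ (Equiv.swap_apply_right p q)
  have hθ' : ∀ a ∈ S, a ≠ p → θ' a = θ a := fun a ha hap ↦ congrArg θ
    (Equiv.swap_apply_of_ne_of_ne hap (ne_of_mem_of_not_mem ha hpend.notMem))
  have hp' : ∀ a ∈ S, ∀ o', DirAdj T o' p a → DirAdj D o' (θ' p) (θ' a) := by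
    intro a ha o' hadj
    have hap : a ≠ p := by
      rintro rfl
      exact not_dirAdj_self hT hadj
    rw [hθ'p, hθ' a ha hap]
    exact hp.2 o' a hadj
  have hS : EmbedsOn T D S θ' := by
    intro a ha b hb hab
    by_cases hap : a = p
    · subst hap
      exact hp' b hb true hab
    by_cases hbp : b = p
    · subst hbp
      exact hp' a ha false hab
    rw [hθ' a ha hap, hθ' b hb hbp]
    exact hθ a ha b hb hab
  refine embedsOn_insert hT hS hpend (fun _ _ ↦ rfl) ?_
  rw [hθ'q, hθ' s hpend.mem hps.symm]
  exact hp.1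

/-- Switching `p` with `q` moves only these two vertices. A vertex none of whose closed neighbours
has been moved is switchable for `θ` if it is for `φ`, so few moves never exhaust all switches. -/
lemma exists_embedsOn_insert_of_switchable (hT : T.Loopless)
    (hd : ∀ o v, #(dirNbrs T o v) ≤ d) {j : ℕ} (hj : j < l)
    (hsw : ∀ o u w, (4 * d + 2) * l ≤ #(switchable T D φ o u w)) (hθ : EmbedsOn T (D ⊔ R) S θ)
    (hmoved : #{x | θ x ≠ φ x} ≤ 2 * j) (hpend : Pendant T S s q o) :
    ∃ θ' : Equiv.Perm V, EmbedsOn T (D ⊔ R) (insert q S) θ' ∧ #{x | θ' x ≠ φ x} ≤ 2 * (j + 1) := by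
  set M : Finset V := {x | θ x ≠ φ x} with hM
  have hbad : #(insert s (M.biUnion (closedNbrs T))) <
      #(switchable T D φ o (θ s) (θ q)) := by
    have hinsert := card_insert_le s (M.biUnion (closedNbrs T))
    have hunion := card_biUnion_le_card_mul M _ _ fun v _ ↦ card_closedNbrs_le hd v
    have hmul := Nat.mul_le_mul_right (2 * d + 1) hmoved
    have hmul' := Nat.mul_le_mul_left (4 * d + 2) (show j + 1 ≤ l from hj)
    have := hsw o (θ s) (θ q)
    have : (4 * d + 2) * (j + 1) = 2 * j * (2 * d + 1) + (4 * d + 2) := by ring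
    omega
  obtain ⟨p, hp, hpbad⟩ := exists_mem_notMem_of_card_lt_card hbad
  simp only [mem_insert, mem_biUnion, not_or, not_exists, not_and] at hpbad
  have hunmoved : ∀ a ∈ closedNbrs T p, θ a = φ a := by
    intro a ha
    by_contra hne
    exact hpbad.2 a (by simpa [hM] using hne) (mem_closedNbrs_comm.1 ha)
  have hpθ := switchable_subset_sup T D R _ _ _ _ (mem_switchable_of_eqOn hunmoved hp)
  refine ⟨_, embedsOn_swap_trans hT hθ hpend hpθ hpbad.1, ?_⟩
  have hsub : ({x | (Equiv.swap p q).trans θ x ≠ φ x} : Finset V) ⊆ insert p (insert q M) := by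
    intro x hx
    by_contra h
    simp only [mem_insert, not_or, hM, mem_filter, mem_univ, true_and, not_not] at h
    exact (mem_filter.1 hx).2
      ((congrArg θ (Equiv.swap_apply_of_ne_of_ne h.1 h.2.1)).trans h.2.2)
  have hcard := card_le_card hsub
  have := card_insert_le p (insert q M)
  have := card_insert_le q M
  omega

omit [DecidableEq V] in
theorem contained_of_switchable (hT : T.IsOrientedTree) (hd : ∀ o v, #(dirNbrs T o v) ≤ d)
    (hconn : (T.toSimpleGraphInclusive.induce (S : Set V)).Connected)
    (hS : #S + l = Fintype.card V) (hφ : EmbedsOn T R S φ)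
    (hsw : ∀ o u w, (4 * d + 2) * l ≤ #(switchable T D φ o u w)) : T.Contained (D ⊔ R) := by
  classical
  obtain ⟨S', -, hS', -, θ, hθ, -⟩ := exists_connected_superset hT
    (P := fun S' ↦ ∃ θ : Equiv.Perm V, EmbedsOn T (D ⊔ R) S' θ ∧
      #{x | θ x ≠ φ x} ≤ 2 * (#S' - #S))
    (m := Fintype.card V) hconn ⟨φ, fun a ha b hb hab ↦ Or.inr (hφ a ha b hb hab), by simp⟩
    (card_le_univ S) le_rfl fun S' s q o hsub hlt hpend ⟨θ, hθ, hmoved⟩ ↦ by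
      have hle := card_le_card hsub
      rw [card_insert_of_notMem hpend.notMem, Nat.sub_add_comm hle]
      exact exists_embedsOn_insert_of_switchable hT.1 hd (by omega) hsw hθ hmoved hpend
  obtain rfl := (card_eq_iff_eq_univ S').1 hS'
  exact ⟨θ, θ.injective, fun a b hab ↦ hθ a (mem_univ a) b (mem_univ b) hab⟩

end Switching

section Permutations

variable {V ι : Type*} [Fintype V] [DecidableEq V] {g : Equiv.Perm V → ℝ} {P Q : Finset V}
  {Y : V → Finset V} {β : ℝ} {t : ℕ}

lemma sum_filter_apply_mem_eq {x y : V} (hg : ∀ π π' : Equiv.Perm V,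
    (∀ z ∈ Q, π z = π' z) → g π = g π') (hx : x ∉ Q) (hy : y ∉ Q) (Y : Finset V) :
    ∑ π : Equiv.Perm V with π y ∈ Y, g π = ∑ π : Equiv.Perm V with π x ∈ Y, g π := by
  rw [sum_filter, sum_filter, ← Equiv.sum_comp (Equiv.mulRight (Equiv.swap x y))]
  refine sum_congr rfl fun π _ ↦ ?_
  have hval : g (π * Equiv.swap x y) = g π := hg _ _ fun z hz ↦ congrArg π <|
    Equiv.swap_apply_of_ne_of_ne (ne_of_mem_of_not_mem hz hx) (ne_of_mem_of_not_mem hz hy)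
  rw [Equiv.coe_mulRight, hval, Equiv.Perm.mul_apply, Equiv.swap_apply_right]

lemma card_le_card_filter_apply_mem_add (π : Equiv.Perm V) (Q Y : Finset V) :
    #Y ≤ #{x ∈ Qᶜ | π x ∈ Y} + #Q := by
  have hsub : Y ⊆ ({x ∈ Qᶜ | π x ∈ Y} ∪ Q).image π := by
    intro y hy
    refine mem_image.2 ⟨π.symm y, ?_, π.apply_symm_apply y⟩
    simpa [hy] using em' (π.symm y ∈ Q)
  exact (card_le_card hsub).trans (card_image_le.trans (card_union_le _ _))

/-- Conditionally on its values on `Q`, a uniformly random permutation maps every other point into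
`Y` with the same probability, and at least `#Y - #Q` of these points are mapped into `Y`. -/
lemma mul_sum_le_sum_filter_apply_mem (hg₀ : ∀ π, 0 ≤ g π)
    (hg : ∀ π π' : Equiv.Perm V, (∀ z ∈ Q, π z = π' z) → g π = g π') {x : V} (hx : x ∉ Q)
    {Y : Finset V} (hY : β * Fintype.card V + #Q ≤ #Y) :
    β * ∑ π, g π ≤ ∑ π : Equiv.Perm V with π x ∈ Y, g π := by
  set s := ∑ π : Equiv.Perm V with π x ∈ Y, g π
  have hcount : ∀ π : Equiv.Perm V, β * Fintype.card V ≤ #{y ∈ Qᶜ | π y ∈ Y} := by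
    intro π
    have : (#Y : ℝ) ≤ #{y ∈ Qᶜ | π y ∈ Y} + #Q := by
      exact_mod_cast card_le_card_filter_apply_mem_add π Q Y
    linarith
  have hcard : (0 : ℝ) < Fintype.card V := by exact_mod_cast Fintype.card_pos_iff.2 ⟨x⟩
  refine le_of_mul_le_mul_left ?_ hcard
  calc
    Fintype.card V * (β * ∑ π, g π) = ∑ π, β * Fintype.card V * g π := by
      rw [← mul_sum]
      ring
    _ ≤ ∑ π, (#{y ∈ Qᶜ | π y ∈ Y} : ℝ) * g π :=
      sum_le_sum fun π _ ↦ mul_le_mul_of_nonneg_right (hcount π) (hg₀ π)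
    _ = ∑ y ∈ Qᶜ, ∑ π : Equiv.Perm V with π y ∈ Y, g π := by
      simp only [sum_filter]
      rw [sum_comm]
      refine sum_congr rfl fun π _ ↦ ?_
      rw [← sum_filter, sum_const, nsmul_eq_mul]
    _ = #Qᶜ * s := by
      rw [sum_congr rfl fun y hy ↦ sum_filter_apply_mem_eq hg hx (mem_compl.1 hy) Y, sum_const,
        nsmul_eq_mul]
    _ ≤ Fintype.card V * s := by
      gcongr
      · exact sum_nonneg fun π _ ↦ hg₀ π
      · exact card_le_univ _

lemma pow_mul_sum_le_sum_filter_forall_mem (hg₀ : ∀ π, 0 ≤ g π)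
    (hg : ∀ π π' : Equiv.Perm V, (∀ z ∈ Q, π z = π' z) → g π = g π') (hβ : 0 ≤ β)
    (hPQ : Disjoint P Q) (hY : ∀ x ∈ P, β * Fintype.card V + #Q + #P ≤ #(Y x)) :
    β ^ #P * ∑ π, g π ≤ ∑ π : Equiv.Perm V with ∀ x ∈ P, π x ∈ Y x, g π := by
  induction P using Finset.induction_on with
  | empty => simp
  | insert p P hp ih =>
    rw [card_insert_of_notMem hp] at hY ⊢
    push_cast at hY
    rw [disjoint_insert_left] at hPQ
    let h : Equiv.Perm V → ℝ := fun π ↦ if ∀ x ∈ P, π x ∈ Y x then g π else 0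
    have hh : ∀ π π' : Equiv.Perm V, (∀ z ∈ Q ∪ P, π z = π' z) → h π = h π' := by
      intro π π' heq
      have hiff : (∀ x ∈ P, π x ∈ Y x) ↔ ∀ x ∈ P, π' x ∈ Y x :=
        forall₂_congr fun x hx ↦ by rw [heq x (mem_union_right Q hx)]
      simp only [h, hiff, hg π π' fun z hz ↦ heq z (mem_union_left P hz)]
    have hYp : β * Fintype.card V + #(Q ∪ P) ≤ #(Y p) := by
      have : (#(Q ∪ P) : ℝ) ≤ #Q + #P := by exact_mod_cast card_union_le Q P
      linarith [hY p (mem_insert_self p P)]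
    calc
      β ^ (#P + 1) * ∑ π, g π = β * (β ^ #P * ∑ π, g π) := by ring
      _ ≤ β * ∑ π, h π := by
        rw [← sum_filter]
        exact mul_le_mul_of_nonneg_left
          (ih hPQ.2 fun x hx ↦ by linarith [hY x (mem_insert_of_mem hx)]) hβ
      _ ≤ ∑ π : Equiv.Perm V with π p ∈ Y p, h π :=
        mul_sum_le_sum_filter_apply_mem
          (fun π ↦ by simp only [h]; split_ifs; exacts [hg₀ π, le_rfl]) hh
          (by simp [hp, hPQ.1]) hYp
      _ = ∑ π : Equiv.Perm V with ∀ x ∈ insert p P, π x ∈ Y x, g π := by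
        simp only [h, ← sum_filter, filter_filter, forall_mem_insert]

lemma sum_ite_half_mul_le (hg₀ : ∀ π, 0 ≤ g π)
    (hg : ∀ π π' : Equiv.Perm V, (∀ z ∈ Q, π z = π' z) → g π = g π') (hβ : 0 ≤ β) (hβ₁ : β ≤ 1)
    (hPQ : Disjoint P Q) (hP : #P ≤ t)
    (hY : ∀ x ∈ P, β * Fintype.card V + #Q + #P ≤ #(Y x)) :
    ∑ π : Equiv.Perm V, (if ∀ x ∈ P, π x ∈ Y x then 1 / 2 else 1) * g π ≤
      (1 - β ^ t / 2) * ∑ π, g π := by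
  have hhit := pow_mul_sum_le_sum_filter_forall_mem hg₀ hg hβ hPQ hY
  have hpow : β ^ t * ∑ π, g π ≤ β ^ #P * ∑ π, g π :=
    mul_le_mul_of_nonneg_right (pow_le_pow_of_le_one hβ hβ₁ hP) (sum_nonneg fun π _ ↦ hg₀ π)
  have hsplit : ∑ π : Equiv.Perm V, (if ∀ x ∈ P, π x ∈ Y x then 1 / 2 else 1) * g π =
      ∑ π, g π - (∑ π : Equiv.Perm V with ∀ x ∈ P, π x ∈ Y x, g π) / 2 := by
    rw [sum_filter, sum_div, ← sum_sub_distrib]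
    refine sum_congr rfl fun π _ ↦ ?_
    split_ifs <;> ring
  rw [hsplit]
  linarith

variable {P : ι → Finset V} {Y : ι → V → Finset V} {I : Finset ι}

lemma sum_half_pow_card_filter_le (hβ : 0 ≤ β) (hβ₁ : β ≤ 1) (hP : ∀ i ∈ I, #(P i) ≤ t)
    (hdisj : (I : Set ι).PairwiseDisjoint P)
    (hY : ∀ i ∈ I, ∀ x ∈ P i, β * Fintype.card V + t * #I ≤ #(Y i x)) :
    ∑ π : Equiv.Perm V, (1 / 2 : ℝ) ^ #{i ∈ I | ∀ x ∈ P i, π x ∈ Y i x} ≤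
      (1 - β ^ t / 2) ^ #I * Fintype.card (Equiv.Perm V) := by
  classical
  induction I using Finset.induction_on with
  | empty => simp
  | insert j I hj ih =>
    rw [card_insert_of_notMem hj] at hY ⊢
    push_cast at hY
    have hPI : ∀ i ∈ I, #(P i) ≤ t := fun i hi ↦ hP i (mem_insert_of_mem hi)
    have ih := ih hPI (hdisj.subset (coe_subset.2 (subset_insert j I))) fun i hi x hx ↦ by
      linarith [hY i (mem_insert_of_mem hi) x hx, t.cast_nonneg (α := ℝ)]
    let g : Equiv.Perm V → ℝ := fun π ↦ (1 / 2) ^ #{i ∈ I | ∀ x ∈ P i, π x ∈ Y i x}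
    have hg : ∀ π π' : Equiv.Perm V, (∀ z ∈ I.biUnion P, π z = π' z) → g π = g π' := by
      intro π π' heq
      refine congrArg (fun s ↦ (1 / 2 : ℝ) ^ #s) (filter_congr fun i hi ↦ ?_)
      exact forall₂_congr fun x hx ↦ by rw [heq x (mem_biUnion.2 ⟨i, hi, hx⟩)]
    have hPj : Disjoint (P j) (I.biUnion P) := (disjoint_biUnion_right _ _ _).2 fun i hi ↦
      hdisj (mem_insert_self j I) (mem_insert_of_mem hi) (ne_of_mem_of_not_mem hi hj).symm
    have hYj : ∀ x ∈ P j, β * Fintype.card V + #(I.biUnion P) + #(P j) ≤ #(Y j x) := by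
      intro x hx
      have hunion : (#(I.biUnion P) : ℝ) ≤ #I * t := by
        exact_mod_cast card_biUnion_le_card_mul _ _ _ hPI
      have hcard : (#(P j) : ℝ) ≤ t := by exact_mod_cast hP j (mem_insert_self j I)
      linarith [hY j (mem_insert_self j I) x hx]
    calc
      ∑ π : Equiv.Perm V, (1 / 2 : ℝ) ^ #{i ∈ insert j I | ∀ x ∈ P i, π x ∈ Y i x}
          = ∑ π : Equiv.Perm V, (if ∀ x ∈ P j, π x ∈ Y j x then 1 / 2 else 1) * g π := by
        refine sum_congr rfl fun π _ ↦ ?_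
        rw [filter_insert]
        split_ifs
        · rw [card_insert_of_notMem fun h ↦ hj (mem_filter.1 h).1, pow_succ']
        · rw [one_mul]
      _ ≤ (1 - β ^ t / 2) * ∑ π, g π :=
        sum_ite_half_mul_le (fun π ↦ by positivity) hg hβ hβ₁ hPj (hP j (mem_insert_self j I)) hYj
      _ ≤ (1 - β ^ t / 2) * ((1 - β ^ t / 2) ^ #I * Fintype.card (Equiv.Perm V)) := by
        have := pow_le_one₀ (n := t) hβ hβ₁
        exact mul_le_mul_of_nonneg_left ih (by linarith)
      _ = (1 - β ^ t / 2) ^ (#I + 1) * Fintype.card (Equiv.Perm V) := by ring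

theorem card_filter_card_filter_lt_le (hβ : 0 ≤ β) (hβ₁ : β ≤ 1) (hP : ∀ i ∈ I, #(P i) ≤ t)
    (hdisj : (I : Set ι).PairwiseDisjoint P)
    (hY : ∀ i ∈ I, ∀ x ∈ P i, β * Fintype.card V + t * #I ≤ #(Y i x)) (K : ℕ) :
    (#{π : Equiv.Perm V | #{i ∈ I | ∀ x ∈ P i, π x ∈ Y i x} < K} : ℝ) ≤
      2 ^ K * (1 - β ^ t / 2) ^ #I * Fintype.card (Equiv.Perm V) := by
  set B : Finset (Equiv.Perm V) := {π | #{i ∈ I | ∀ x ∈ P i, π x ∈ Y i x} < K}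
  calc
    (#B : ℝ) = 2 ^ K * ∑ π ∈ B, (1 / 2) ^ K := by
      rw [sum_const, nsmul_eq_mul, mul_left_comm, ← mul_pow]
      norm_num
    _ ≤ 2 ^ K * ∑ π ∈ B, (1 / 2) ^ #{i ∈ I | ∀ x ∈ P i, π x ∈ Y i x} := by
      refine mul_le_mul_of_nonneg_left (sum_le_sum fun π hπ ↦ ?_) (by positivity)
      exact pow_le_pow_of_le_one (by norm_num) (by norm_num) (mem_filter.1 hπ).2.le
    _ ≤ 2 ^ K * ∑ π : Equiv.Perm V, (1 / 2) ^ #{i ∈ I | ∀ x ∈ P i, π x ∈ Y i x} := by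
      gcongr
      exact subset_univ B
    _ ≤ 2 ^ K * ((1 - β ^ t / 2) ^ #I * Fintype.card (Equiv.Perm V)) := by
      gcongr
      exact sum_half_pow_card_filter_le hβ hβ₁ hP hdisj hY
    _ = 2 ^ K * (1 - β ^ t / 2) ^ #I * Fintype.card (Equiv.Perm V) := (mul_assoc _ _ _).symm

end Permutations

section CountingSwitchable

open Digraph

variable {V : Type*} [Fintype V] [DecidableEq V] {D T : Digraph V} {d N : ℕ} {o : Bool} {β : ℝ}
  {i u w : V}

lemma exists_pairwiseDisjoint_closedNbrs (hd : ∀ o v, #(dirNbrs T o v) ≤ d)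
    (hN : N * (2 * d + 1) ^ 2 ≤ Fintype.card V) :
    ∃ I : Finset V, #I = N ∧ (I : Set V).PairwiseDisjoint (closedNbrs T) := by
  induction N with
  | zero => exact ⟨∅, by simp, by simp⟩
  | succ N ih =>
    rw [add_one_mul] at hN
    obtain ⟨I, rfl, hdisj⟩ := ih (by omega)
    have hball : ∀ X : Finset V, #(X.biUnion (closedNbrs T)) ≤ #X * (2 * d + 1) := fun X ↦
      card_biUnion_le_card_mul X _ _ fun v _ ↦ card_closedNbrs_le hd v
    have hcard : #((I.biUnion (closedNbrs T)).biUnion (closedNbrs T)) < #(univ : Finset V) :=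
      calc
        _ ≤ #I * (2 * d + 1) * (2 * d + 1) := (hball _).trans (Nat.mul_le_mul_right _ (hball I))
        _ < #I * (2 * d + 1) ^ 2 + (2 * d + 1) ^ 2 := by
          rw [mul_assoc, ← sq]
          exact Nat.lt_add_of_pos_right (by positivity)
        _ ≤ #(univ : Finset V) := hN
    obtain ⟨j, -, hj⟩ := exists_mem_notMem_of_card_lt_card hcard
    have hdisj' : ∀ i ∈ I, Disjoint (closedNbrs T j) (closedNbrs T i) := fun i hi ↦
      disjoint_left.2 fun x hxj hxi ↦
        hj (mem_biUnion.2 ⟨x, mem_biUnion.2 ⟨i, hi, hxi⟩, mem_closedNbrs_comm.1 hxj⟩)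
    have hself : ∀ v, v ∈ closedNbrs T v := fun v ↦ mem_closedNbrs.2 (.inl rfl)
    have hjI : j ∉ I := fun h ↦ disjoint_left.1 (hdisj' j h) (hself j) (hself j)
    refine ⟨insert j I, card_insert_of_notMem hjI, ?_⟩
    rw [coe_insert]
    exact hdisj.insert fun i hi _ ↦ hdisj' i hi

open Classical in
/-- The set to which `x`, a closed neighbour of `i`, has to be mapped in order that `i` be
switchable with respect to `o`, `u` and `w`. -/
noncomputable def targets (T D : Digraph V) (o : Bool) (u w i x : V) : Finset V :=
  if x = i then dirNbrs D o u else dirNbrs D (decide (T.Adj i x)) w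

lemma mem_switchable_of_forall_mem_targets (hT : T.IsOrientedTree) {φ : V → V}
    (h : ∀ x ∈ closedNbrs T i, φ x ∈ targets T D o u w i x) : i ∈ switchable T D φ o u w := by
  classical
  rw [mem_switchable]
  refine ⟨by simpa [targets] using h i (mem_closedNbrs.2 (.inl rfl)), fun o' a ha ↦ ?_⟩
  have hai : a ≠ i := by
    rintro rfl
    exact not_dirAdj_self hT.1 ha
  have hdir : decide (T.Adj i a) = o' := by
    cases o'
    · exact decide_eq_false (hT.2.1 a i ha)
    · exact decide_eq_true ha
  simpa [targets, hai, hdir] using h a (mem_closedNbrs.2 (.inr ⟨o', ha⟩))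

lemma card_filter_card_switchable_lt_le (hT : T.IsOrientedTree)
    (hd : ∀ o v, #(dirNbrs T o v) ≤ d) (hβ : 0 ≤ β) (hβ₁ : β ≤ 1)
    (hN : N * (2 * d + 1) ^ 2 ≤ Fintype.card V)
    (hD : ∀ o v, β * Fintype.card V + (2 * d + 1) * N ≤ #(dirNbrs D o v))
    (o : Bool) (u w : V) (K : ℕ) :
    (#{φ : Equiv.Perm V | #(switchable T D φ o u w) < K} : ℝ) ≤
      2 ^ K * (1 - β ^ (2 * d + 1) / 2) ^ N * Fintype.card (Equiv.Perm V) := by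
  obtain ⟨I, rfl, hdisj⟩ := exists_pairwiseDisjoint_closedNbrs hd hN
  have htargets : ∀ i ∈ I, ∀ x ∈ closedNbrs T i,
      β * Fintype.card V + (2 * d + 1 : ℕ) * #I ≤ #(targets T D o u w i x) := by
    intro i _ x _
    push_cast
    unfold targets
    split_ifs <;> exact hD _ _
  refine le_trans ?_ (card_filter_card_filter_lt_le hβ hβ₁
    (fun i _ ↦ card_closedNbrs_le hd i) hdisj htargets K)
  gcongr
  exact fun i hi ↦ mem_switchable_of_forall_mem_targets hT (mem_filter.1 hi).2

theorem card_filter_exists_card_switchable_lt_le (hT : T.IsOrientedTree)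
    (hd : ∀ o v, #(dirNbrs T o v) ≤ d) (hβ : 0 ≤ β) (hβ₁ : β ≤ 1)
    (hN : N * (2 * d + 1) ^ 2 ≤ Fintype.card V)
    (hD : ∀ o v, β * Fintype.card V + (2 * d + 1) * N ≤ #(dirNbrs D o v)) (K : ℕ) :
    (#{φ : Equiv.Perm V | ∃ o u w, #(switchable T D φ o u w) < K} : ℝ) ≤
      2 * Fintype.card V ^ 2 * (2 ^ K * (1 - β ^ (2 * d + 1) / 2) ^ N) *
        Fintype.card (Equiv.Perm V) := by
  let B : Bool × V × V → Finset (Equiv.Perm V) := fun z ↦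
    {φ | #(switchable T D φ z.1 z.2.1 z.2.2) < K}
  have hunion : ({φ | ∃ o u w, #(switchable T D φ o u w) < K} : Finset (Equiv.Perm V)) =
      univ.biUnion B := by
    ext φ
    simp [B]
  rw [hunion]
  calc
    (#(univ.biUnion B) : ℝ) ≤ ∑ z, (#(B z) : ℝ) := by exact_mod_cast card_biUnion_le
    _ ≤ ∑ _z : Bool × V × V,
        2 ^ K * (1 - β ^ (2 * d + 1) / 2) ^ N * Fintype.card (Equiv.Perm V) :=
      sum_le_sum fun z _ ↦ card_filter_card_switchable_lt_le hT hd hβ hβ₁ hN hD z.1 z.2.1 z.2.2 K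
    _ = _ := by
      simp only [sum_const, card_univ, Fintype.card_prod, Fintype.card_bool, nsmul_eq_mul]
      push_cast
      ring

end CountingSwitchable

section RandomDigraph

open Digraph MeasureTheory ProbabilityTheory

lemma measurePreserving_image_setBernoulli {ι κ : Type*} (e : ι ≃ κ) (u : Set ι)
    (p : unitInterval) :
    MeasurePreserving (e '' ·) (setBernoulli u p) (setBernoulli (e '' u) p) := by
  have hmeas : Measurable fun s : Set ι ↦ e '' s := by
    simp only [Equiv.image_eq_preimage_symm]
    exact measurable_set_iff.2 fun j ↦ measurable_set_mem (e.symm j)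
  have hcomm : (e '' ·) ∘ (fun q : ι → Prop ↦ {i | q i}) =
      (fun q : κ → Prop ↦ {j | q j}) ∘ MeasurableEquiv.piCongrLeft (fun _ ↦ Prop) e := by
    ext q j
    obtain ⟨i, rfl⟩ := e.surjective j
    simp [MeasurableEquiv.coe_piCongrLeft]
  refine ⟨hmeas, ?_⟩
  rw [setBernoulli_eq_map, setBernoulli_eq_map, Measure.map_map hmeas (by fun_prop), hcomm,
    ← Measure.map_map (by fun_prop) (by fun_prop), ← Measure.infinitePi_map_piCongrLeft _ e]
  simp

lemma setBernoulli_real_forall_notMem {ι : Type*} {u : Set ι} (p : unitInterval) {F : Finset ι}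
    (hF : (F : Set ι) ⊆ u) :
    (setBernoulli u p).real {s | ∀ i ∈ F, i ∉ s} = (1 - p : ℝ) ^ #F := by
  have hpi : (fun q : ι → Prop ↦ {i | q i}) ⁻¹' {s : Set ι | ∀ i ∈ F, i ∉ s} =
      Set.pi F fun _ ↦ {False} := by
    ext q
    simp
  have hprob : ∀ i ∈ F, (unitInterval.toNNReal p • Measure.dirac (i ∈ u) +
      unitInterval.toNNReal (unitInterval.symm p) • Measure.dirac False) {False} =
      unitInterval.toNNReal (unitInterval.symm p) := fun i hi ↦ by simp [hF hi]
  rw [measureReal_def, setBernoulli_apply', hpi, Measure.infinitePi_pi _ (by simp),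
    prod_congr rfl hprob]
  simp

lemma mul_measureReal_le_of_forall_mul_card_le {Ω ι : Type*} [MeasurableSpace Ω] [Fintype ι]
    [Nonempty ι] {μ : Measure Ω} [IsFiniteMeasure μ] {g : ι → Ω → Ω}
    (hg : ∀ i, MeasurePreserving (g i) μ μ) {J G : Set Ω} (hJ : MeasurableSet J)
    (hG : MeasurableSet G) [DecidablePred (· ∈ G)] {η : ℝ}
    (h : ∀ ω ∈ J, η * Fintype.card ι ≤ #{i | g i ω ∈ G}) : η * μ.real J ≤ μ.real G := by
  have hcard : (0 : ℝ) < Fintype.card ι := by exact_mod_cast Fintype.card_pos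
  refine le_of_mul_le_mul_left ?_ hcard
  have hint : ∀ i, Integrable ((g i ⁻¹' G).indicator (1 : Ω → ℝ)) μ := fun i ↦
    (integrable_const 1).indicator ((hg i).measurable hG)
  calc
    Fintype.card ι * (η * μ.real J) = ∫ ω, J.indicator (fun _ ↦ η * Fintype.card ι) ω ∂μ := by
      rw [integral_indicator_const _ hJ, smul_eq_mul]
      ring
    _ ≤ ∫ ω, ∑ i, (g i ⁻¹' G).indicator 1 ω ∂μ := by
      refine integral_mono ((integrable_const _).indicator hJ)
        (integrable_finsetSum _ fun i _ ↦ hint i) fun ω ↦ ?_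
      have hcount : ∑ i, (g i ⁻¹' G).indicator (1 : Ω → ℝ) ω = #{i | g i ω ∈ G} := by
        classical simp [Set.indicator_apply]
      exact (Set.indicator_le' h (fun _ _ ↦ Nat.cast_nonneg _) ω).trans_eq hcount.symm
    _ = Fintype.card ι * μ.real G := by
      rw [integral_finsetSum _ fun i _ ↦ hint i]
      simp only [integral_indicator_one ((hg _).measurable hG), (hg _).measureReal_preimage
        hG.nullMeasurableSet, sum_const, card_univ, nsmul_eq_mul]

variable {V : Type*}

/-- The effect on edge sets of a relabelling `π` of the vertices. -/
def mapEdges (π : Equiv.Perm V) (E : Set (V × V)) : Set (V × V) :=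
  π.prodCongr π '' E

lemma adj_ofEdgeSet_mapEdges {π : Equiv.Perm V} {E : Set (V × V)} {a b : V}
    (h : (ofEdgeSet E).Adj a b) : (ofEdgeSet (mapEdges π E)).Adj (π a) (π b) :=
  ⟨(a, b), h, rfl⟩

lemma measurePreserving_mapEdges (π : Equiv.Perm V) (p : unitInterval) :
    MeasurePreserving (mapEdges π) (binomialRandomEdges V p) (binomialRandomEdges V p) := by
  have hne : π.prodCongr π '' {e : V × V | e.1 ≠ e.2} = {e | e.1 ≠ e.2} := by
    rw [Equiv.image_eq_preimage_symm]
    ext ⟨x, y⟩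
    simp
  have h := measurePreserving_image_setBernoulli (π.prodCongr π) {e : V × V | e.1 ≠ e.2} p
  rwa [hne] at h

instance isProbabilityMeasure_binomialRandomEdges (p : unitInterval) :
    IsProbabilityMeasure (binomialRandomEdges V p) :=
  inferInstanceAs (IsProbabilityMeasure (setBernoulli _ p))

lemma mul_sub_one_le_card_filter_ne [DecidableEq V] {X Y : Finset V} {k : ℕ} (hX : k ≤ #X)
    (hY : k ≤ #Y) : k * (k - 1) ≤ #{e ∈ X ×ˢ Y | ¬ e.1 = e.2} := by
  have hdiag : #{e ∈ X ×ˢ Y | e.1 = e.2} ≤ #X := by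
    rw [← diag_card X]
    refine card_le_card fun e he ↦ ?_
    rw [mem_filter, mem_product] at he
    exact mem_diag.2 ⟨he.1.1, he.2⟩
  have hsum := card_filter_add_card_filter_not (s := X ×ˢ Y) fun e ↦ e.1 = e.2
  have hmul : k * (k - 1) ≤ #X * (#Y - 1) := Nat.mul_le_mul hX (by omega)
  rw [card_product] at hsum
  rw [Nat.mul_sub_one #X] at hmul
  omega

theorem binomialRandomEdges_real_not_isJoined_le [Fintype V] (p : unitInterval) (k : ℕ) :
    (binomialRandomEdges V p).real {E | ¬ IsJoined (ofEdgeSet E) k} ≤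
      4 ^ Fintype.card V * (1 - p : ℝ) ^ (k * (k - 1)) := by
  classical
  have hp₀ : (0 : ℝ) ≤ 1 - p := sub_nonneg.2 p.2.2
  have hp₁ : (1 - p : ℝ) ≤ 1 := sub_le_self 1 p.2.1
  let I : Finset (Finset V × Finset V) := {z | k ≤ #z.1 ∧ k ≤ #z.2}
  let F : Finset V × Finset V → Finset (V × V) := fun z ↦ {e ∈ z.1 ×ˢ z.2 | ¬ e.1 = e.2}
  have hsub : {E : Set (V × V) | ¬ IsJoined (ofEdgeSet E) k} ⊆
      ⋃ z ∈ I, {E | ∀ e ∈ F z, e ∉ E} := by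
    intro E hE
    simp only [Set.mem_ofPred_eq, IsJoined] at hE
    push Not at hE
    obtain ⟨X, Y, hX, hY, h⟩ := hE
    refine Set.mem_biUnion (x := (X, Y)) (by simp [I, hX, hY]) ?_
    rintro ⟨x, y⟩ he
    have hxy := mem_product.1 (mem_filter.1 he).1
    exact h x hxy.1 y hxy.2
  have hI : #I ≤ 4 ^ Fintype.card V := by
    refine (card_le_univ I).trans_eq ?_
    rw [Fintype.card_prod, Fintype.card_finset, ← mul_pow]
    norm_num
  calc
    (binomialRandomEdges V p).real {E | ¬ IsJoined (ofEdgeSet E) k}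
        ≤ (binomialRandomEdges V p).real (⋃ z ∈ I, {E | ∀ e ∈ F z, e ∉ E}) :=
      measureReal_mono hsub (measure_ne_top _ _)
    _ ≤ ∑ z ∈ I, (binomialRandomEdges V p).real {E | ∀ e ∈ F z, e ∉ E} :=
      measureReal_biUnion_finset_le _ _
    _ ≤ ∑ _z ∈ I, (1 - p : ℝ) ^ (k * (k - 1)) := by
      refine sum_le_sum fun z hz ↦ ?_
      have hF : (F z : Set (V × V)) ⊆ {e | e.1 ≠ e.2} := fun e he ↦ (mem_filter.1 he).2
      rw [binomialRandomEdges, setBernoulli_real_forall_notMem p hF]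
      obtain ⟨hX, hY⟩ := (mem_filter.1 hz).2
      exact pow_le_pow_of_le_one hp₀ hp₁ (mul_sub_one_le_card_filter_ne hX hY)
    _ ≤ 4 ^ Fintype.card V * (1 - p : ℝ) ^ (k * (k - 1)) := by
      rw [sum_const, nsmul_eq_mul]
      gcongr
      exact_mod_cast hI

end RandomDigraph

section Quantitative

open Digraph MeasureTheory

variable {V : Type*} [Fintype V] {D T : Digraph V} {d k N : ℕ} {β : ℝ}

open Classical in
/-- The switchable sets of `T` for the embedding `π ∘ ψ`, where `ψ` embeds most of `T` into `E`,
only depend on `π ∘ ψ`, and this runs through all permutations as `π` does. -/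
lemma card_filter_le_card_filter_contained_mapEdges [DecidableEq V] {E : Set (V × V)}
    (hE : IsJoined (ofEdgeSet E) k) (hT : T.IsOrientedTree) (hd : ∀ o v, #(dirNbrs T o v) ≤ d)
    (hk : (4 * d + 9) * k < Fintype.card V) :
    #{φ : Equiv.Perm V | ∀ o u w, (4 * d + 2) * ((4 * d + 9) * k) ≤ #(switchable T D φ o u w)} ≤
      #{π : Equiv.Perm V | T.Contained (D ⊔ ofEdgeSet (mapEdges π E))} := by
  obtain ⟨S, ψ, hS, hconn, hψ⟩ := hE.exists_embedsOn hT hd hk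
  refine card_le_card_of_injOn (· * ψ⁻¹) (fun φ hφ ↦ ?_) (mul_left_injective _).injOn
  refine mem_coe.2 (mem_filter.2 ⟨mem_univ _, ?_⟩)
  refine contained_of_switchable hT hd hconn hS (φ := φ) (fun a ha b hb hab ↦ ?_)
    (mem_filter.1 hφ).2
  simpa using adj_ofEdgeSet_mapEdges (π := φ * ψ⁻¹) (hψ a ha b hb hab)

theorem one_sub_sub_le_binomialRandomEdges_real_contained (hT : T.IsOrientedTree)
    (hd : ∀ o v, #(dirNbrs T o v) ≤ d) (hk : (4 * d + 9) * k < Fintype.card V) (hβ : 0 ≤ β)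
    (hβ₁ : β ≤ 1) (hN : N * (2 * d + 1) ^ 2 ≤ Fintype.card V)
    (hD : ∀ o v, β * Fintype.card V + (2 * d + 1) * N ≤ #(dirNbrs D o v)) (p : unitInterval) :
    1 - 2 * Fintype.card V ^ 2 *
        (2 ^ ((4 * d + 2) * ((4 * d + 9) * k)) * (1 - β ^ (2 * d + 1) / 2) ^ N) -
      4 ^ Fintype.card V * (1 - p : ℝ) ^ (k * (k - 1)) ≤
    (binomialRandomEdges V p).real {E | T.Contained (D ⊔ ofEdgeSet E)} := by
  classical
  set η : ℝ := 2 * Fintype.card V ^ 2 *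
    (2 ^ ((4 * d + 2) * ((4 * d + 9) * k)) * (1 - β ^ (2 * d + 1) / 2) ^ N)
  have hη₀ : 0 ≤ η := by
    have : 0 ≤ 1 - β ^ (2 * d + 1) / 2 := by linarith [pow_le_one₀ (n := 2 * d + 1) hβ hβ₁]
    positivity
  have hgood : ∀ E : Set (V × V), IsJoined (ofEdgeSet E) k →
      (1 - η) * Fintype.card (Equiv.Perm V) ≤
        #{π : Equiv.Perm V | T.Contained (D ⊔ ofEdgeSet (mapEdges π E))} := by
    intro E hE
    have hbad := card_filter_exists_card_switchable_lt_le hT hd hβ hβ₁ hN hD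
      ((4 * d + 2) * ((4 * d + 9) * k))
    have hle := card_filter_le_card_filter_contained_mapEdges (D := D) hE hT hd hk
    have hsum := card_filter_add_card_filter_not (s := (univ : Finset (Equiv.Perm V)))
      fun φ ↦ ∃ o u w, #(switchable T D φ o u w) < (4 * d + 2) * ((4 * d + 9) * k)
    simp only [not_exists, not_lt, card_univ] at hsum
    rw [sub_mul, one_mul, sub_le_iff_le_add']
    refine le_trans ?_ (add_le_add hbad (Nat.cast_le.2 hle))
    exact_mod_cast hsum.ge
  have hmain := mul_measureReal_le_of_forall_mul_card_le (measurePreserving_mapEdges · p)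
    (Set.toFinite {E | IsJoined (ofEdgeSet E) k}).measurableSet
    (Set.toFinite {E | T.Contained (D ⊔ ofEdgeSet E)}).measurableSet hgood
  have hjoined := binomialRandomEdges_real_not_isJoined_le (V := V) p k
  have hcompl : (binomialRandomEdges V p).real {E | ¬ IsJoined (ofEdgeSet E) k} =
      1 - (binomialRandomEdges V p).real {E | IsJoined (ofEdgeSet E) k} :=
    probReal_compl_eq_one_sub (Set.toFinite _).measurableSet
  have hη₁ : η * (binomialRandomEdges V p).real {E | IsJoined (ofEdgeSet E) k} ≤ η :=
    mul_le_of_le_one_right hη₀ measureReal_le_one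
  linarith

end Quantitative

section Asymptotics

open Digraph Filter Topology

lemma card_dirNbrs_eq_ncard {V : Type*} [Fintype V] (D : Digraph V) (o : Bool) (v : V) :
    #(dirNbrs D o v) = {w | DirAdj D o v w}.ncard := by
  rw [← Set.ncard_coe_finset]
  simp [dirNbrs]

lemma card_dirNbrs_le_maxTotalDegree {V : Type*} [Fintype V] (T : Digraph V) (o : Bool) (v : V) :
    #(dirNbrs T o v) ≤ T.maxTotalDegree := by
  have hv : T.inDegree v + T.outDegree v ≤ T.maxTotalDegree :=
    le_ciSup (f := fun v ↦ T.inDegree v + T.outDegree v) (Set.finite_range _).bddAbove v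
  rw [card_dirNbrs_eq_ncard]
  cases o
  · exact (Nat.le_add_right _ _).trans hv
  · exact (Nat.le_add_left _ _).trans hv

lemma minSemidegree_le_card_dirNbrs {V : Type*} [Fintype V] (D : Digraph V) (o : Bool) (v : V) :
    D.minSemidegree ≤ #(dirNbrs D o v) := by
  have hv : D.minSemidegree ≤ min (D.outDegree v) (D.inDegree v) :=
    ciInf_le (f := fun v ↦ min (D.outDegree v) (D.inDegree v)) (OrderBot.bddBelow _) v
  rw [card_dirNbrs_eq_ncard]
  cases o
  · exact hv.trans (min_le_right _ _)
  · exact hv.trans (min_le_left _ _)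

lemma mul_card_add_le_card_dirNbrs {V : Type*} [Fintype V] {D : Digraph V} {α β s : ℝ}
    (hD : α * Fintype.card V ≤ D.minSemidegree) (hβ : β ≤ α / 2) (hs : s ≤ β * Fintype.card V)
    (o : Bool) (v : V) : β * Fintype.card V + s ≤ #(dirNbrs D o v) := by
  have hdeg : (D.minSemidegree : ℝ) ≤ #(dirNbrs D o v) :=
    Nat.cast_le.2 (minSemidegree_le_card_dirNbrs D o v)
  have hβn := mul_le_mul_of_nonneg_right hβ (Fintype.card V).cast_nonneg
  linarith

lemma coe_edgeProb {c : ℝ} {n : ℕ} (hc : 0 ≤ c) (hcn : c ≤ n) : (edgeProb c n : ℝ) = c / n := by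
  rw [edgeProb, Set.projIcc_of_mem zero_le_one ⟨by positivity, div_le_one_of_le₀ hcn (by simp)⟩]

lemma pow_mul_one_sub_pow_le_exp {a b q : ℝ} (ha : 0 ≤ a) (hab : a ≤ Real.exp b) (hq : q ≤ 1)
    (m n : ℕ) : a ^ m * (1 - q) ^ n ≤ Real.exp (m * b - n * q) := by
  calc
    a ^ m * (1 - q) ^ n ≤ Real.exp b ^ m * Real.exp (-q) ^ n := by
      have := sub_nonneg.2 hq
      gcongr
      exact Real.one_sub_le_exp_neg q
    _ = Real.exp (m * b - n * q) := by
      rw [← Real.exp_nat_mul, ← Real.exp_nat_mul, ← Real.exp_add, mul_neg, sub_eq_add_neg]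

lemma tendsto_natCast_sq_mul_exp_neg {γ : ℝ} (hγ : 0 < γ) :
    Tendsto (fun n : ℕ ↦ (n : ℝ) ^ 2 * Real.exp (-(γ * n))) atTop (𝓝 0) := by
  have h := ((Real.tendsto_pow_mul_exp_neg_atTop_nhds_zero 2).comp
    (tendsto_natCast_atTop_atTop.const_mul_atTop hγ)).const_mul (γ ^ 2)⁻¹
  rw [mul_zero] at h
  refine h.congr fun n ↦ ?_
  simp only [Function.comp_apply]
  field_simp

lemma tendsto_sq_mul_two_pow_ceil_mul_one_sub_pow_floor {q δ ν : ℝ} {m : ℕ} (hq : 0 ≤ q)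
    (hq₁ : q ≤ 1) (hδ : 0 ≤ δ) (h : m * δ < q * ν) :
    Tendsto (fun n : ℕ ↦ (n : ℝ) ^ 2 * (2 ^ (m * ⌈δ * n⌉₊) * (1 - q) ^ ⌊ν * n⌋₊)) atTop (𝓝 0) := by
  have hlim := (tendsto_natCast_sq_mul_exp_neg (sub_pos.2 h)).const_mul (Real.exp (m + q))
  rw [mul_zero] at hlim
  refine squeeze_zero (fun n ↦ ?_) (fun n ↦ ?_) hlim
  · have := sub_nonneg.2 hq₁
    positivity
  have hceil : m * (⌈δ * n⌉₊ : ℝ) ≤ m * (δ * n + 1) := by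
    have := Nat.ceil_lt_add_one (show 0 ≤ δ * n by positivity)
    gcongr
  have hfloor : q * (ν * n) ≤ q * (⌊ν * n⌋₊ + 1) := by
    have := Nat.lt_floor_add_one (ν * n)
    gcongr
  calc
    (n : ℝ) ^ 2 * (2 ^ (m * ⌈δ * n⌉₊) * (1 - q) ^ ⌊ν * n⌋₊)
        ≤ n ^ 2 * Real.exp ((m * ⌈δ * n⌉₊ : ℕ) * 1 - ⌊ν * n⌋₊ * q) := by
      gcongr
      have htwo : 2 ≤ Real.exp 1 := by linarith [Real.add_one_le_exp 1]
      exact pow_mul_one_sub_pow_le_exp zero_le_two htwo hq₁ _ _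
    _ ≤ n ^ 2 * Real.exp (m + q + -((q * ν - m * δ) * n)) := by
      gcongr
      push_cast
      linarith
    _ = Real.exp (m + q) * (n ^ 2 * Real.exp (-((q * ν - m * δ) * n))) := by
      rw [Real.exp_add]
      ring

lemma tendsto_four_pow_mul_one_sub_edgeProb_pow {δ c : ℝ} (hδ : 0 < δ) (hc : 0 ≤ c)
    (h : 8 ≤ c * δ ^ 2) :
    Tendsto (fun n : ℕ ↦ 4 ^ n * (1 - edgeProb c n : ℝ) ^ (⌈δ * n⌉₊ * (⌈δ * n⌉₊ - 1)))
      atTop (𝓝 0) := by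
  have hlim : Tendsto (fun n : ℕ ↦ Real.exp (-n)) atTop (𝓝 0) :=
    Real.tendsto_exp_neg_atTop_nhds_zero.comp tendsto_natCast_atTop_atTop
  refine squeeze_zero' (.of_forall fun n ↦ ?_) ?_ hlim
  · have := sub_nonneg.2 (edgeProb c n).2.2
    positivity
  have hlarge : Tendsto (fun n : ℕ ↦ δ * n) atTop atTop :=
    tendsto_natCast_atTop_atTop.const_mul_atTop hδ
  filter_upwards [hlarge.eventually_ge_atTop 2,
    tendsto_natCast_atTop_atTop.eventually_ge_atTop c, eventually_gt_atTop 0] with n hδn hcn hn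
  set k := ⌈δ * n⌉₊
  have hk : δ * n ≤ k := Nat.le_ceil _
  have hexponent : 4 * (n : ℝ) ≤ (k * (k - 1) : ℕ) * (c / n) := by
    have hk₁ : 1 ≤ k := (Nat.one_le_cast (α := ℝ)).1 (by linarith)
    have hpairs : δ * n * (δ * n / 2) ≤ (k * (k - 1) : ℕ) := by
      push_cast [hk₁]
      gcongr
      linarith
    calc
      4 * (n : ℝ) ≤ c * δ ^ 2 / 2 * n := by gcongr; linarith
      _ = δ * n * (δ * n / 2) * (c / n) := by field_simp
      _ ≤ (k * (k - 1) : ℕ) * (c / n) := by gcongr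
  have hfour : 4 ≤ Real.exp 2 := by linarith [Real.quadratic_le_exp_of_nonneg zero_le_two]
  refine (pow_mul_one_sub_pow_le_exp zero_le_four hfour (edgeProb c n).2.2 _ _).trans ?_
  rw [coe_edgeProb hc hcn]
  exact Real.exp_le_exp.2 (by linarith [n.cast_nonneg (α := ℝ)])

lemma eventually_mul_ceil_lt {δ : ℝ} {m : ℕ} (hδ : 0 ≤ δ) (h : m * δ < 1) :
    ∀ᶠ n : ℕ in atTop, m * ⌈δ * n⌉₊ < n := by
  have hlim : Tendsto (fun n : ℕ ↦ (1 - m * δ) * n) atTop atTop :=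
    tendsto_natCast_atTop_atTop.const_mul_atTop (sub_pos.2 h)
  filter_upwards [hlim.eventually_gt_atTop m] with n hn
  have hceil : m * (⌈δ * n⌉₊ : ℝ) ≤ m * (δ * n + 1) := by
    have := Nat.ceil_lt_add_one (show 0 ≤ δ * n by positivity)
    gcongr
  exact_mod_cast show (m * ⌈δ * n⌉₊ : ℝ) < n by linarith

lemma exists_edgeProb_error_lt {q ν : ℝ} (hq : 0 < q) (hq₁ : q ≤ 1) (hν : 0 < ν) (hν₁ : ν ≤ 1)
    {l : ℕ} (hl : 0 < l) (m : ℕ) :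
    ∃ c : ℝ, 0 < c ∧ ∃ k : ℕ → ℕ, ∀ ε : ℝ, 0 < ε → ∀ᶠ n : ℕ in atTop, m * k n < n ∧
      2 * (n : ℝ) ^ 2 * (2 ^ (l * (m * k n)) * (1 - q) ^ ⌊ν * n⌋₊) +
        4 ^ n * (1 - edgeProb c n : ℝ) ^ (k n * (k n - 1)) < ε := by
  obtain ⟨δ, hδ, hδqν⟩ := exists_pos_mul_lt (mul_pos hq hν) ((l * m : ℕ) : ℝ)
  have hδ₁ : (m : ℝ) * δ < 1 := calc
    (m : ℝ) * δ ≤ (l * m : ℕ) * δ := by gcongr; exact Nat.le_mul_of_pos_left _ hl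
    _ < q * ν := hδqν
    _ ≤ 1 := mul_le_one₀ hq₁ hν.le hν₁
  refine ⟨8 / δ ^ 2, by positivity, fun n ↦ ⌈δ * n⌉₊, fun ε hε ↦ ?_⟩
  have hswitch := tendsto_sq_mul_two_pow_ceil_mul_one_sub_pow_floor hq.le hq₁ hδ.le hδqν
  have hjoined := tendsto_four_pow_mul_one_sub_edgeProb_pow (c := 8 / δ ^ 2) hδ (by positivity)
    (div_mul_cancel₀ _ (by positivity)).ge
  filter_upwards [eventually_mul_ceil_lt hδ.le hδ₁,
    hswitch.eventually_lt_const (show 0 < ε / 4 by positivity),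
    hjoined.eventually_lt_const (half_pos hε)] with n hroom hswitch hjoined
  refine ⟨hroom, ?_⟩
  rw [← mul_assoc l]
  linarith

end Asymptotics

end RandomlyPerturbed

open RandomlyPerturbed Filter in
theorem theorem1_general (α : ℝ) (hα : 0 < α) (Δ : ℕ) :
    ∃ c : ℝ, 0 < c ∧ ∀ ε : ℝ, 0 < ε → ∃ N : ℕ, ∀ (V : Type*) [Fintype V], N ≤ Fintype.card V →
      ∀ D : Digraph V, α * Fintype.card V ≤ D.minSemidegree →
      ∀ T : Digraph V, T.IsOrientedTree → T.maxTotalDegree ≤ Δ →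
        1 - ε ≤ (Digraph.binomialRandomEdges V (Digraph.edgeProb c (Fintype.card V))).real
          {E | T.Contained (D ⊔ Digraph.ofEdgeSet E)} := by
  classical
  set t : ℕ := 2 * Δ + 1
  have ht : 1 ≤ (t : ℝ) := Nat.one_le_cast.2 (Nat.le_add_left _ _)
  set β : ℝ := min (α / 2) 1
  have hβ : 0 < β := by positivity
  have hβ₁ : β ≤ 1 := min_le_right _ _
  have hq₁ : β ^ t / 2 ≤ 1 := by linarith [pow_le_one₀ (n := t) hβ.le hβ₁]
  have hν₁ : β / t ^ 2 ≤ 1 := div_le_one_of_le₀ (hβ₁.trans (one_le_pow₀ ht)) (by positivity)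
  obtain ⟨c, hc, k, herror⟩ := exists_edgeProb_error_lt (q := β ^ t / 2) (ν := β / t ^ 2)
    (by positivity) hq₁ (by positivity) hν₁ (l := 4 * Δ + 2) (by positivity) (4 * Δ + 9)
  refine ⟨c, hc, fun ε hε ↦ (eventually_atTop.1 (herror ε hε)).imp
    fun N hN V _ hV D hD T hT hTΔ ↦ ?_⟩
  obtain ⟨hroom, herror⟩ := hN _ hV
  have hfloor : (⌊β / t ^ 2 * Fintype.card V⌋₊ : ℝ) * t ^ 2 ≤ β * Fintype.card V := calc
    _ ≤ β / t ^ 2 * Fintype.card V * t ^ 2 := by gcongr; exact Nat.floor_le (by positivity)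
    _ = β * Fintype.card V := by field_simp
  have hlocal : ⌊β / t ^ 2 * Fintype.card V⌋₊ * t ^ 2 ≤ Fintype.card V := by
    exact_mod_cast hfloor.trans (mul_le_of_le_one_left (Nat.cast_nonneg _) hβ₁)
  have hspare : (2 * Δ + 1 : ℝ) * ⌊β / t ^ 2 * Fintype.card V⌋₊ ≤ β * Fintype.card V := by
    rw [mul_comm]
    refine le_trans ?_ hfloor
    gcongr
    exact_mod_cast le_self_pow₀ (Nat.le_add_left 1 (2 * Δ)) two_ne_zero
  have hmain := one_sub_sub_le_binomialRandomEdges_real_contained hT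
    (fun o v ↦ (card_dirNbrs_le_maxTotalDegree T o v).trans hTΔ) hroom hβ.le hβ₁ hlocal
    (mul_card_add_le_card_dirNbrs hD (min_le_left _ _) hspare)
    (Digraph.edgeProb c (Fintype.card V))
  linarith

theorem theorem1 (α : ℝ) (hα0 : 0 < α) (hα1 : α < 1) (Δ : ℕ) :
    ∃ c : ℝ, 0 < c ∧ ∀ ε : ℝ, 0 < ε → ∃ N : ℕ, ∀ n : ℕ, N ≤ n →
      ∀ D : Digraph (Fin n), D.Loopless → α * n ≤ D.minSemidegree →
      ∀ T : Digraph (Fin n), T.IsOrientedTree → T.maxTotalDegree ≤ Δ →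
        1 - ε ≤ (Digraph.binomialRandomEdges (Fin n) (Digraph.edgeProb c n)).real
          {E | T.Contained (D ⊔ Digraph.ofEdgeSet E)} := by
  obtain ⟨c, hc, h⟩ := theorem1_general α hα0 Δ
  refine ⟨c, hc, fun ε hε ↦ (h ε hε).imp fun N hN n hn D _ ↦ ?_⟩
  simpa using hN (Fin n) (by simpa using hn) D
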